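/- Let $\{X_k\}_{k\in\mathbb Z}$ be a real, zero-mean, weakly stationary process on a probability space $(\Omega,\mathcal F,P)$ (that is, $E[X_k^2]<\infty$, $E[X_k]=0$, and $E[X_{j+m}X_{k+m}]=E[X_jX_k]$ for all $j,k,m\in\mathbb Z$) which is not degenerate, that is, $X_0$ is not almost surely $0$. For a set $I\subset\mathbb Z$ let $H_I$ be the closed real linear span of $\{X_k: k\in I\}$ in $L^2(\Omega,\mathcal F,P)$; intervals below are intervals of integers. Then the following two conditions are equivalent: (a) $\{X_k\}$ is nondeterministic, that is, $X_0\notin H_{(-\infty,-1]}$, and $$H_{(-\infty,-1]}\cap H_{[-n,\infty)}=H_{[-n,-1]}\qquad\text{for all } n=1,2,\dots;$$ (b) $\{X_k\}$ is completely nondeterministic, that is, $$H_{(-\infty,-1]}\cap H_{[0,\infty)}=\{0\}.$$ -/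

import Mathlib

open MeasureTheory

/-- A stationary process: a real, zero-mean, weakly stationary (square-integrable, with covariances
invariant under time shifts) process indexed by the integers. -/
structure IsStationaryProcess {Ω : Type*} [MeasurableSpace Ω] (P : Measure Ω)
    (X : ℤ → Ω → ℝ) : Prop where
  memLp : ∀ k, MemLp (X k) 2 P
  mean_zero : ∀ k, ∫ ω, X k ω ∂P = 0
  cov_shift : ∀ j k m, ∫ ω, X (j + m) ω * X (k + m) ω ∂P = ∫ ω, X j ω * X k ω ∂P

namespace IsStationaryProcess

variable {Ω : Type*} [MeasurableSpace Ω] {P : Measure Ω} {X : ℤ → Ω → ℝ}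

/-- The random variable `X k` as an element of the real Hilbert space `L²(P)`. -/
noncomputable def toL2 (hX : IsStationaryProcess P X) (k : ℤ) : Lp ℝ 2 P :=
  (hX.memLp k).toLp (X k)

/-- `H_I`: the closed real linear span in `L²(P)` of the `X k` with `k ∈ I`. -/
noncomputable def closedSpan (hX : IsStationaryProcess P X) (I : Set ℤ) :
    Submodule ℝ (Lp ℝ 2 P) :=
  (Submodule.span ℝ (hX.toL2 '' I)).topologicalClosure

/-- The process is nondeterministic: `X 0` is not in the closed span of the past. -/
def Nondeterministic (hX : IsStationaryProcess P X) : Prop :=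
  hX.toL2 0 ∉ hX.closedSpan (Set.Iic (-1))

/-- The intersection of the past `H_(-∞,-1]` and of `H_[-n,∞)` is `H_[-n,-1]` for all `n ≥ 1`. -/
def IntersectionProperty (hX : IsStationaryProcess P X) : Prop :=
  ∀ n : ℕ, 1 ≤ n →
    hX.closedSpan (Set.Iic (-1)) ⊓ hX.closedSpan (Set.Ici (-(n : ℤ))) =
      hX.closedSpan (Set.Icc (-(n : ℤ)) (-1))

/-- The process is completely nondeterministic: the past `H_(-∞,-1]` and the future `H_[0,∞)`
meet only in zero. -/
def CompletelyNondeterministic (hX : IsStationaryProcess P X) : Prop :=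
  hX.closedSpan (Set.Iic (-1)) ⊓ hX.closedSpan (Set.Ici 0) = ⊥

end IsStationaryProcess

/-! If past and future meet only in zero, split `H_[-n,∞)` as `H_[-n,-1] + H_[0,∞)`; since
`H_[-n,-1]` lies in the past, the modular law gives the intersection property. Conversely, its case
`n = 1` confines a common element of past and future to the line through `X (-1)`; were it nonzero,
`X (-1)` would lie in `H_[0,∞)`, which time reversal forbids, because real stationary covariances
are symmetric in the lag. -/

open scoped RealInnerProductSpace in
/-- Linear combinations of two families with the same Gram matrix have the same norm. -/
theorem norm_linearCombination_eq_of_inner_eq {ι E F : Type*}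
    [NormedAddCommGroup E] [InnerProductSpace ℝ E] [NormedAddCommGroup F] [InnerProductSpace ℝ F]
    {u : ι → E} {v : ι → F} (h : ∀ i j, ⟪u i, u j⟫ = ⟪v i, v j⟫) (f : ι →₀ ℝ) :
    ‖Finsupp.linearCombination ℝ u f‖ = ‖Finsupp.linearCombination ℝ v f‖ := by
  rw [← sq_eq_sq₀ (norm_nonneg _) (norm_nonneg _), ← real_inner_self_eq_norm_sq,
    ← real_inner_self_eq_norm_sq]
  simp only [Finsupp.linearCombination_apply, Finsupp.sum, sum_inner, inner_sum,
    real_inner_smul_left, real_inner_smul_right, h]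

open scoped RealInnerProductSpace in
/-- Membership of one vector of a family in the closed span of others depends only on the
Gram matrix. -/
theorem mem_topologicalClosure_span_of_inner_eq {ι E F : Type*}
    [NormedAddCommGroup E] [InnerProductSpace ℝ E] [NormedAddCommGroup F] [InnerProductSpace ℝ F]
    {u : ι → E} {v : ι → F} (h : ∀ i j, ⟪u i, u j⟫ = ⟪v i, v j⟫) {I : Set ι} {i : ι}
    (hu : u i ∈ (Submodule.span ℝ (u '' I)).topologicalClosure) :
    v i ∈ (Submodule.span ℝ (v '' I)).topologicalClosure := by
  rw [← SetLike.mem_coe, Submodule.topologicalClosure_coe, Metric.mem_closure_iff] at hu ⊢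
  intro ε hε
  obtain ⟨y, hy, hd⟩ := hu ε hε
  obtain ⟨f, hf, rfl⟩ := (Finsupp.mem_span_image_iff_linearCombination ℝ).1 hy
  refine ⟨_, (Finsupp.mem_span_image_iff_linearCombination ℝ).2 ⟨f, hf, rfl⟩, ?_⟩
  -- The error of approximating `u i` by a combination is itself the norm of a combination.
  have key := norm_linearCombination_eq_of_inner_eq h (Finsupp.single i 1 - f)
  simp only [map_sub, Finsupp.linearCombination_single, one_smul] at key
  rwa [dist_eq_norm, ← key, ← dist_eq_norm]

namespace IsStationaryProcess

variable {Ω : Type*} [MeasurableSpace Ω] {P : Measure Ω} {X : ℤ → Ω → ℝ}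

theorem inner_toL2 (hX : IsStationaryProcess P X) (j k : ℤ) :
    inner ℝ (hX.toL2 j) (hX.toL2 k) = ∫ ω, X j ω * X k ω ∂P := by
  rw [L2.inner_def]
  refine integral_congr_ae ?_
  filter_upwards [(hX.memLp j).coeFn_toLp, (hX.memLp k).coeFn_toLp] with ω hj hk
  simp only [toL2, hj, hk, RCLike.inner_apply, conj_trivial, mul_comm]

/-- The time reversal `k ↦ -1 - k` preserves covariances. -/
theorem inner_toL2_reflect (hX : IsStationaryProcess P X) (j k : ℤ) :
    inner ℝ (hX.toL2 j) (hX.toL2 k) = inner ℝ (hX.toL2 (-1 - j)) (hX.toL2 (-1 - k)) := by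
  -- Shifting by `j + k + 1` sends `-1 - j` to `k` and `-1 - k` to `j`.
  rw [real_inner_comm, inner_toL2, inner_toL2, ← hX.cov_shift (-1 - j) (-1 - k) (j + k + 1)]
  congr! 5 <;> ring

theorem closedSpan_mono (hX : IsStationaryProcess P X) {I J : Set ℤ} (h : I ⊆ J) :
    hX.closedSpan I ≤ hX.closedSpan J :=
  Submodule.topologicalClosure_mono (Submodule.span_mono (Set.image_mono h))

theorem toL2_mem_closedSpan (hX : IsStationaryProcess P X) {I : Set ℤ} {k : ℤ} (hk : k ∈ I) :
    hX.toL2 k ∈ hX.closedSpan I :=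
  Submodule.le_topologicalClosure _ (Submodule.subset_span (Set.mem_image_of_mem _ hk))

theorem closedSpan_eq_span (hX : IsStationaryProcess P X) {I : Set ℤ} (hI : I.Finite) :
    hX.closedSpan I = Submodule.span ℝ (hX.toL2 '' I) := by
  have := FiniteDimensional.span_of_finite ℝ (hI.image hX.toL2)
  exact (Submodule.closed_of_finiteDimensional _).submodule_topologicalClosure_eq

/-- The sum on the right needs no closure: a closed subspace plus a finite-dimensional one is
closed. -/
theorem closedSpan_union_le (hX : IsStationaryProcess P X) {I : Set ℤ} (hI : I.Finite)
    (J : Set ℤ) : hX.closedSpan (I ∪ J) ≤ hX.closedSpan I ⊔ hX.closedSpan J := by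
  have := FiniteDimensional.span_of_finite ℝ (hI.image hX.toL2)
  have hc : IsClosed ((hX.closedSpan I ⊔ hX.closedSpan J : Submodule ℝ (Lp ℝ 2 P)) :
      Set (Lp ℝ 2 P)) := by
    rw [sup_comm, hX.closedSpan_eq_span hI]
    exact Submodule.isClosed_sup_finiteDimensional _ _
      (Submodule.isClosed_topologicalClosure _)
  refine Submodule.topologicalClosure_minimal _ ?_ hc
  rw [Set.image_union, Submodule.span_union]
  exact sup_le_sup (Submodule.le_topologicalClosure _) (Submodule.le_topologicalClosure _)

/-- A nondeterministic process is nondeterministic backwards in time. -/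
theorem Nondeterministic.reverse {hX : IsStationaryProcess P X} (h : hX.Nondeterministic) :
    hX.toL2 (-1) ∉ hX.closedSpan (Set.Ici 0) := by
  intro hmem
  have h0 := mem_topologicalClosure_span_of_inner_eq
    (v := fun k => hX.toL2 (-1 - k)) hX.inner_toL2_reflect hmem
  refine h (Submodule.topologicalClosure_mono (Submodule.span_mono ?_) h0)
  rintro _ ⟨k, hk, rfl⟩
  exact ⟨-1 - k, by simp only [Set.mem_Ici, Set.mem_Iic] at *; omega, rfl⟩

theorem Nondeterministic.completelyNondeterministic {hX : IsStationaryProcess P X}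
    (h : hX.Nondeterministic) (hI : hX.IntersectionProperty) :
    hX.CompletelyNondeterministic := by
  rw [CompletelyNondeterministic, Submodule.eq_bot_iff]
  rintro x ⟨hp, hf⟩
  have hx : x ∈ hX.closedSpan (Set.Icc (-((1 : ℕ) : ℤ)) (-1)) :=
    hI 1 le_rfl ▸ ⟨hp, hX.closedSpan_mono (Set.Ici_subset_Ici.2 (by simp)) hf⟩
  rw [hX.closedSpan_eq_span (Set.finite_Icc _ _), Nat.cast_one, Set.Icc_self,
    Set.image_singleton] at hx
  obtain ⟨c, rfl⟩ := Submodule.mem_span_singleton.1 hx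
  by_contra hne
  -- A nonzero element of the line has `c ≠ 0`, so `c` can be divided out.
  exact h.reverse ((Submodule.smul_mem_iff _ (left_ne_zero_of_smul hne)).1 hf)

theorem CompletelyNondeterministic.nondeterministic {hX : IsStationaryProcess P X}
    (h : hX.CompletelyNondeterministic) (hX0 : ¬ X 0 =ᵐ[P] 0) : hX.Nondeterministic := by
  intro hmem
  have h0 : hX.toL2 0 ∈ (⊥ : Submodule ℝ (Lp ℝ 2 P)) :=
    h ▸ ⟨hmem, hX.toL2_mem_closedSpan (Set.mem_Ici.2 le_rfl)⟩
  exact hX0 ((hX.memLp 0).coeFn_toLp.symm.trans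
    ((Lp.eq_zero_iff_ae_eq_zero).1 ((Submodule.mem_bot ℝ).1 h0)))

theorem CompletelyNondeterministic.intersectionProperty {hX : IsStationaryProcess P X}
    (h : hX.CompletelyNondeterministic) : hX.IntersectionProperty := by
  intro n _
  have hpast : hX.closedSpan (Set.Icc (-(n : ℤ)) (-1)) ≤ hX.closedSpan (Set.Iic (-1)) :=
    hX.closedSpan_mono Set.Icc_subset_Iic_self
  refine le_antisymm ?_ (le_inf hpast (hX.closedSpan_mono Set.Icc_subset_Ici_self))
  have hsub : Set.Ici (-(n : ℤ)) ⊆ Set.Icc (-(n : ℤ)) (-1) ∪ Set.Ici 0 := by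
    intro k hk
    simp only [Set.mem_union, Set.mem_Icc, Set.mem_Ici] at *
    omega
  calc hX.closedSpan (Set.Iic (-1)) ⊓ hX.closedSpan (Set.Ici (-(n : ℤ)))
      ≤ (hX.closedSpan (Set.Icc (-(n : ℤ)) (-1)) ⊔ hX.closedSpan (Set.Ici 0)) ⊓
          hX.closedSpan (Set.Iic (-1)) := by
        rw [inf_comm]
        exact inf_le_inf_right _ ((hX.closedSpan_mono hsub).trans
          (hX.closedSpan_union_le (Set.finite_Icc _ _) _))
    _ = hX.closedSpan (Set.Icc (-(n : ℤ)) (-1)) ⊔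
          hX.closedSpan (Set.Ici 0) ⊓ hX.closedSpan (Set.Iic (-1)) :=
        sup_inf_assoc_of_le _ hpast
    _ = hX.closedSpan (Set.Icc (-(n : ℤ)) (-1)) := by
        rw [inf_comm, show _ ⊓ _ = _ from h, sup_bot_eq]

end IsStationaryProcess

theorem theorem2p3 {Ω : Type*} [MeasurableSpace Ω] (P : Measure Ω) [IsProbabilityMeasure P]
    (X : ℤ → Ω → ℝ) (hX : IsStationaryProcess P X) (hX0 : ¬ X 0 =ᵐ[P] 0) :
    (hX.Nondeterministic ∧ hX.IntersectionProperty) ↔ hX.CompletelyNondeterministic :=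
  ⟨fun h => h.1.completelyNondeterministic h.2,
    fun h => ⟨h.nondeterministic hX0, h.intersectionProperty⟩⟩
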